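/- Let $\Bbbk$ be a field and let $Q\subseteq\mathbb Z^d$ be an affine semigroup, i.e. a finitely generated submonoid, that has no nonzero units and generates $\mathbb Z^d$ as a group; $Q$ need not be saturated. Let $Q^{\rm sat}=\{\alpha\in\mathbb Z^d : n\alpha\in Q\text{ for some } n\ge 1\}$. A face of $Q$ is a nonempty set of the form of all points of $Q$ at which some linear functional attains its minimum on $Q$; its dimension is the rank of the group $\mathbb ZF$ it generates, and a facet of $F$ is a face $D\subseteq F$ with $\dim D=\dim F-1$. For a set $T$ of exponents write $\Bbbk\{T\}$ for the $\Bbbk$-span of the monomials $\mathbf x^b$, $b\in T$; for a face $F$ let $P_F=\Bbbk\{Q\setminus F\}\subset\Bbbk[Q]$. For an ideal $I$ and a module $M$ put $(0:_M I)=\{m\in M: Im=0\}$ and $\Gamma_I M=\bigcup_n(0:_M I^n)$. Write $a+F-S=\{a+f-s : f\in F,\ s\in S\}$. Let $F$ be a face of $Q$ and $a\in Q$. Consider the following algorithm, in which "generators" always means a finite set of nonzero homogeneous generators of a $\mathbb Z^d$-graded $\Bbbk[Q]$-module, chosen arbitrarily. Define $V=\Bbbk\{Q^{\rm sat}\setminus(a+F-Q^{\rm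 sat})\}$, an ideal of $\Bbbk[Q^{\rm sat}]$ (the saturated answer), $W=V\cap\Bbbk[Q]$, and $I=\bigcap\{P_D : D\text{ a facet of }F\}$ (so $I=\Bbbk[Q]$ if $F$ has no facets). Initialize $B$ as the set of degrees of generators of $W$, and $\overline W:=\Bbbk[Q]/W$. While generators of $(0:_{\overline W}P_F)$ include one in a degree $\not\equiv a\pmod{\mathbb ZF}$, do: let $G$ be the set of those of these generators that lie in degrees $\not\equiv a\pmod{\mathbb ZF}$; add the degrees of the elements of $G$ to $B$, and replace $\overline W$ by $\overline W/\langle G\rangle$; then let $G'$ be generators of $\Gamma_I\overline W$; add the degrees of the elements of $G'$ to $B$, and replace $\overline W$ by $\overline W/\langle G'\rangle$. When the loop ends, output $B$. Then, whatever generators are chosen, the required generators exist at every step, the algorithm terminates, and its output is a finite set $B\subset Q$ such that $$\langle \mathbf x^b \mid b\in B\rangle=\Bbbk\{Q\setminus(a+F-Q)\}$$ as ideals of $\Bbbk[Q]$; moreover this ideal is irreducible, i.e. it is proper and is not the intersection of two ideals properly containing it. -/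

import Mathlib

namespace UnsatAlgorithm

/-- The semigroup algebra `k[S]` of a submonoid `S` of `ℤ^d`, with monomials `x^b` for `b ∈ S`. -/
abbrev Alg (k : Type*) [Field k] {d : ℕ} (S : AddSubmonoid (Fin d → ℤ)) : Type _ :=
  AddMonoidAlgebra k S

/-- The monomial `x^b`. -/
noncomputable def mono (k : Type*) [Field k] {d : ℕ} {S : AddSubmonoid (Fin d → ℤ)} (b : S) :
    Alg k S :=
  AddMonoidAlgebra.single b 1

/-- `k{T}`: the `k`-vector subspace of `k[S]` spanned by the monomials with exponent in `T`. -/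
noncomputable def kspan (k : Type*) [Field k] {d : ℕ} {S : AddSubmonoid (Fin d → ℤ)}
    (T : Set S) : Submodule k (Alg k S) :=
  Submodule.span k (mono k '' T)

/-- `⟨x^b | b ∈ T⟩`: the ideal of `k[S]` generated by the monomials with exponent in `T`. -/
noncomputable def monoIdeal (k : Type*) [Field k] {d : ℕ} {S : AddSubmonoid (Fin d → ℤ)}
    (T : Set S) : Ideal (Alg k S) :=
  Ideal.span (mono k '' T)

/-- If `T` is closed under addition of elements of `S`, then the ideal generated by the monomials
`x^b`, `b ∈ T`, is just `k{T}`. -/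
theorem monoIdeal_eq_kspan (k : Type*) [Field k] {d : ℕ} {S : AddSubmonoid (Fin d → ℤ)}
    (T : Set S) (hT : ∀ b ∈ T, ∀ s : S, b + s ∈ T) :
    (monoIdeal k T).restrictScalars k = kspan k T := by
  apply le_antisymm
  · have key : ∀ p ∈ kspan k T, ∀ r : Alg k S, r * p ∈ kspan k T := by
      intro p hp r
      induction hp using Submodule.span_induction with
      | mem x hx =>
        obtain ⟨b, hb, rfl⟩ := hx
        induction r using AddMonoidAlgebra.induction_linear with
        | zero => simp
        | add f g hf hg => rw [add_mul]; exact add_mem hf hg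
        | single s c =>
          have : (AddMonoidAlgebra.single s c : Alg k S) * mono k b = c • mono k (b + s) := by
            simp [mono, AddMonoidAlgebra.single_mul_single, add_comm]
          rw [this]
          exact Submodule.smul_mem _ _ (Submodule.subset_span ⟨_, hT b hb s, rfl⟩)
      | zero => simp
      | add x y _ _ hx hy => rw [mul_add]; exact add_mem hx hy
      | smul c x _ hx => rw [mul_smul_comm]; exact Submodule.smul_mem _ _ hx
    intro p hp
    rw [Submodule.restrictScalars_mem] at hp
    induction hp using Submodule.span_induction with
    | mem x hx => exact Submodule.subset_span hx
    | zero => exact zero_mem _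
    | add x y _ _ hx hy => exact add_mem hx hy
    | smul r x _ hx => exact key x hx r
  · exact Submodule.span_le.2 fun x hx => Ideal.subset_span hx

/-- The saturation `Q^sat` of `Q` in `ℤ^d`: all `α` some positive multiple of which is in `Q`. -/
def saturation {d : ℕ} (Q : AddSubmonoid (Fin d → ℤ)) : AddSubmonoid (Fin d → ℤ) where
  carrier := {α | ∃ n : ℕ, 0 < n ∧ n • α ∈ Q}
  zero_mem' := ⟨1, one_pos, by simp⟩
  add_mem' := by
    rintro α β ⟨m, hm, hα⟩ ⟨n, hn, hβ⟩
    refine ⟨m * n, Nat.mul_pos hm hn, ?_⟩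
    rw [smul_add, mul_smul m n β, mul_comm m n, mul_smul n m α]
    exact add_mem (nsmul_mem hα n) (nsmul_mem hβ m)

theorem le_saturation {d : ℕ} (Q : AddSubmonoid (Fin d → ℤ)) : Q ≤ saturation Q :=
  fun α hα => ⟨1, one_pos, by simpa using hα⟩

/-- `F` is a face of `Q`: the (nonempty) set of points of `Q` at which some linear functional
attains its minimum on `Q`. -/
def IsFace {d : ℕ} (Q : AddSubmonoid (Fin d → ℤ)) (F : Set (Fin d → ℤ)) : Prop :=
  F.Nonempty ∧ ∃ l : (Fin d → ℤ) →+ ℝ, F = {q | q ∈ Q ∧ ∀ q' ∈ Q, l q ≤ l q'}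

/-- The dimension of a face: the rank of the group `ℤF`. -/
noncomputable def faceDim {d : ℕ} (F : Set (Fin d → ℤ)) : ℕ :=
  Module.finrank ℤ (Submodule.span ℤ F)

/-- `D` is a facet of the face `F` of `Q`: a face contained in `F`, of dimension one less. -/
def IsFacetOf {d : ℕ} (Q : AddSubmonoid (Fin d → ℤ)) (D F : Set (Fin d → ℤ)) : Prop :=
  IsFace Q D ∧ D ⊆ F ∧ faceDim D + 1 = faceDim F

/-- The set `a + F - S ⊆ ℤ^d`. -/
def translate {d : ℕ} (a : Fin d → ℤ) (F : Set (Fin d → ℤ)) (S : AddSubmonoid (Fin d → ℤ)) :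
    Set (Fin d → ℤ) :=
  {α | ∃ f ∈ F, ∃ s ∈ S, α = a + f - s}

/-- The set `S ∖ (a + F - S)`, as a set of elements of `S`. -/
def cut {d : ℕ} (S : AddSubmonoid (Fin d → ℤ)) (F : Set (Fin d → ℤ)) (a : Fin d → ℤ) : Set S :=
  {b | (b : Fin d → ℤ) ∉ translate a F S}

/-- The prime ideal `P_F = k{Q ∖ F}` of `k[Q]` belonging to a face `F`. -/
noncomputable def facePrime (k : Type*) [Field k] {d : ℕ} (Q : AddSubmonoid (Fin d → ℤ))
    (F : Set (Fin d → ℤ)) : Ideal (Alg k Q) :=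
  monoIdeal k {q : Q | (q : Fin d → ℤ) ∉ F}

/-- `I = ⋂ P_D` over the facets `D` of `F` (the unit ideal if `F` has no facets). -/
noncomputable def facetIdeal (k : Type*) [Field k] {d : ℕ} (Q : AddSubmonoid (Fin d → ℤ))
    (F : Set (Fin d → ℤ)) : Ideal (Alg k Q) :=
  ⨅ D ∈ {D : Set (Fin d → ℤ) | IsFacetOf Q D F}, facePrime k Q D

/-- `V = k{Q^sat ∖ (a + F - Q^sat)}`, an ideal of `k[Q^sat]`: the kernel of the surjection from
`k[Q^sat]` onto the irreducible sum `k{a + F - Q^sat}_{Q^sat}`. -/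
noncomputable def satIdeal (k : Type*) [Field k] {d : ℕ} (Q : AddSubmonoid (Fin d → ℤ))
    (F : Set (Fin d → ℤ)) (a : Fin d → ℤ) : Ideal (Alg k (saturation Q)) :=
  monoIdeal k (cut (saturation Q) F a)

/-- `W = V ∩ k[Q]`, the intersection taken inside `k[Q^sat]`. -/
noncomputable def startIdeal (k : Type*) [Field k] {d : ℕ} (Q : AddSubmonoid (Fin d → ℤ))
    (F : Set (Fin d → ℤ)) (a : Fin d → ℤ) : Ideal (Alg k Q) :=
  (satIdeal k Q F a).comap
    (AddMonoidAlgebra.mapDomainRingHom k (AddSubmonoid.inclusion (le_saturation Q)))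

section Graded

variable {k : Type*} [Field k] {d : ℕ} {Q : AddSubmonoid (Fin d → ℤ)}
  {M : Type*} [AddCommGroup M] [Module (Alg k Q) M]

/-- For a graded quotient `π : k[Q] → M`: `w` is a nonzero homogeneous element of degree `b`,
that is, the image of a scalar multiple of `x^b`. -/
def HasDegree (π : Alg k Q →ₗ[Alg k Q] M) (w : M) (b : Q) : Prop :=
  w ≠ 0 ∧ ∃ c : k, w = π (AddMonoidAlgebra.single b c)

/-- `G` is a finite set of nonzero homogeneous generators of the submodule `N`. -/
def IsHomGenerators (π : Alg k Q →ₗ[Alg k Q] M) (N : Submodule (Alg k Q) M) (G : Set M) : Prop :=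
  G.Finite ∧ (∀ g ∈ G, ∃ b, HasDegree π g b) ∧ Submodule.span (Alg k Q) G = N

/-- The degrees of the elements in `G`. -/
def degrees (π : Alg k Q →ₗ[Alg k Q] M) (G : Set M) : Set Q :=
  {b | ∃ g ∈ G, HasDegree π g b}

/-- The elements of `G` that lie in degrees not congruent to `a` modulo `ℤF`. -/
def offDegree (π : Alg k Q →ₗ[Alg k Q] M) (F : Set (Fin d → ℤ)) (a : Fin d → ℤ) (G : Set M) :
    Set M :=
  {g ∈ G | ∃ b, HasDegree π g b ∧ (b : Fin d → ℤ) - a ∉ AddSubgroup.closure F}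

/-- `Γ_I M = (0 :_M I^∞)`: the elements annihilated by some power of `I`. -/
noncomputable def powerTorsion (I : Ideal (Alg k Q)) (M : Type*) [AddCommGroup M] [Module (Alg k Q) M] :
    Submodule (Alg k Q) M :=
  ⨆ n : ℕ, Submodule.torsionBySet (Alg k Q) M ((I ^ n : Ideal (Alg k Q)) : Set (Alg k Q))

/-- The kernel of `k[Q] → (k[Q]/J)/⟨G⟩`, for a set `G` of elements of `k[Q]/J`. -/
noncomputable def killIdeal (J : Ideal (Alg k Q)) (G : Set (Alg k Q ⧸ J)) : Ideal (Alg k Q) :=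
  (Submodule.span (Alg k Q) G).comap J.mkQ

end Graded

/-- Where a run of the algorithm stands: about to evaluate the loop condition, in the middle of
the loop body (before the second half), or finished. -/
inductive Stage
  | test
  | body
  | done

/-- A state of the algorithm: the place in the program, the current set `B` of degrees, and the
current module, stored as the kernel `J` of the surjection from `k[Q]` onto it. -/
structure State (k : Type*) [Field k] {d : ℕ} (Q : AddSubmonoid (Fin d → ℤ)) where
  stage : Stage
  B : Set Q
  J : Ideal (Alg k Q)

/-- Initialization: the module is `k[Q]/W`, and `B` consists of the degrees of some finite set of
homogeneous generators of `W`. -/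
def Initial (k : Type*) [Field k] {d : ℕ} (Q : AddSubmonoid (Fin d → ℤ))
    (F : Set (Fin d → ℤ)) (a : Fin d → ℤ) (s : State k Q) : Prop :=
  ∃ G : Set (Alg k Q), IsHomGenerators LinearMap.id (startIdeal k Q F a) G ∧
    s = ⟨Stage.test, degrees LinearMap.id G, startIdeal k Q F a⟩

/-- One step of the algorithm. Every choice of generators is allowed. -/
inductive Step (k : Type*) [Field k] {d : ℕ} (Q : AddSubmonoid (Fin d → ℤ))
    (F : Set (Fin d → ℤ)) (a : Fin d → ℤ) : State k Q → State k Q → Prop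
  /-- No generator of `(0 : P_F)` lies in a degree not congruent to `a`: leave the loop. -/
  | exit (B : Set Q) (J : Ideal (Alg k Q)) (H : Set (Alg k Q ⧸ J))
      (hH : IsHomGenerators J.mkQ
        (Submodule.torsionBySet (Alg k Q) (Alg k Q ⧸ J) (facePrime k Q F : Set (Alg k Q))) H)
      (hoff : offDegree J.mkQ F a H = ∅) :
      Step k Q F a ⟨Stage.test, B, J⟩ ⟨Stage.done, B, J⟩
  /-- Some generator does: with `G` the set of these generators, add their degrees to `B` and
  divide the module by them. -/
  | strip (B : Set Q) (J : Ideal (Alg k Q)) (H : Set (Alg k Q ⧸ J))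
      (hH : IsHomGenerators J.mkQ
        (Submodule.torsionBySet (Alg k Q) (Alg k Q ⧸ J) (facePrime k Q F : Set (Alg k Q))) H)
      (hoff : (offDegree J.mkQ F a H).Nonempty) :
      Step k Q F a ⟨Stage.test, B, J⟩
        ⟨Stage.body, B ∪ degrees J.mkQ (offDegree J.mkQ F a H),
          killIdeal J (offDegree J.mkQ F a H)⟩
  /-- With `G'` a set of generators of `Γ_I` of the module, add their degrees to `B`, divide the
  module by them, and return to the loop condition. -/
  | torsion (B : Set Q) (J : Ideal (Alg k Q)) (G' : Set (Alg k Q ⧸ J))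
      (hG' : IsHomGenerators J.mkQ (powerTorsion (facetIdeal k Q F) (Alg k Q ⧸ J)) G') :
      Step k Q F a ⟨Stage.body, B, J⟩
        ⟨Stage.test, B ∪ degrees J.mkQ G', killIdeal J G'⟩

/-- The states that some run of the algorithm reaches. -/
def Reachable (k : Type*) [Field k] {d : ℕ} (Q : AddSubmonoid (Fin d → ℤ))
    (F : Set (Fin d → ℤ)) (a : Fin d → ℤ) (s : State k Q) : Prop :=
  ∃ s₀, Initial k Q F a s₀ ∧ Relation.ReflTransGen (Step k Q F a) s₀ s

end UnsatAlgorithm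

/-! Write C for `k{Q ∖ (a + F - Q)}` and J for the kernel of `k[Q]` onto the current module. Every
ideal that occurs is monomial, so the work is with exponents, and the loop invariant is W ⊆ J = ⟨x^b
: b ∈ B⟩ ⊆ C.

Neither half of the loop leaves C. If b survives modulo C, then b + s = a + f with f ∈ F, s ∈ Q. If
moreover P_F kills x^b modulo C, then s ∈ F, so b ≡ a mod ℤF; hence generators in other degrees
already lie in C. For Γ_I, take a point q of F in no facet: x^q ∈ I, while adding multiples of q
keeps b inside a + F - Q.

At exit J = C. Some power of P_F lies in W ⊆ J, because a functional cutting out F is bounded above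
on a + F - Q^sat. So if C ⊄ J, some monomial x^b of C outside J is killed by P_F modulo J. It is a
multiple of a generator of degree ≡ a by a monomial of F, so b ≡ a mod ℤF, which puts b in a + F -
Q: a contradiction. The Γ_I half only has to be harmless.

Termination is the ascending chain condition, since each pass divides by nonzero elements. For
irreducibility, every ideal above C contains x^a r with 0 ≠ r ∈ k[F]; for two such ideals x^a r s
lies in both, but not in C, as `k[Q]` is a domain. -/

namespace UnsatAlgorithm

/-! ### Monomial ideals of semigroup algebras -/

section Monomial

variable {k : Type*} [Field k] {d : ℕ} {S : AddSubmonoid (Fin d → ℤ)}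

/-- An ideal of `k[S]` is monomial if it contains all monomials of its elements. -/
def IsMonomial (J : Ideal (Alg k S)) : Prop :=
  ∀ p ∈ J, ∀ b, p.coeff b ≠ 0 → mono k b ∈ J

theorem mono_mul_mono (b c : S) : mono k b * mono k c = mono k (b + c) := by
  simp [mono, AddMonoidAlgebra.single_mul_single]

theorem single_mem_of_mono_mem {J : Ideal (Alg k S)} {b : S} (h : mono k b ∈ J) (c : k) :
    AddMonoidAlgebra.single b c ∈ J := by
  have := J.mul_mem_left (AddMonoidAlgebra.single 0 c) h
  simpa [mono, AddMonoidAlgebra.single_mul_single] using this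

theorem mono_mem_of_single_mem {J : Ideal (Alg k S)} {b : S} {c : k} (hc : c ≠ 0)
    (h : AddMonoidAlgebra.single b c ∈ J) : mono k b ∈ J := by
  have := J.mul_mem_left (AddMonoidAlgebra.single 0 c⁻¹) h
  simpa [mono, AddMonoidAlgebra.single_mul_single, hc] using this

theorem mem_of_mono_mem {J : Ideal (Alg k S)} {p : Alg k S}
    (h : ∀ b, p.coeff b ≠ 0 → mono k b ∈ J) : p ∈ J := by
  rw [← p.sum_coeff_single]
  exact Ideal.sum_mem _ fun b hb =>
    single_mem_of_mono_mem (h b (Finsupp.mem_support_iff.1 hb)) _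

theorem coeff_mono_mul (s b : S) (p : Alg k S) :
    (mono k s * p).coeff (s + b) = p.coeff b := by
  simp [mono]

theorem coeff_mul_ne_zero {p q : Alg k S} {b : S} (h : (p * q).coeff b ≠ 0) :
    ∃ s t, p.coeff s ≠ 0 ∧ q.coeff t ≠ 0 ∧ b = s + t := by
  classical
  have := AddMonoidAlgebra.support_coeff_mul_subset p q (Finsupp.mem_support_iff.2 h)
  obtain ⟨s, hs, t, ht, e⟩ := Finset.mem_add.1 this
  exact ⟨s, t, Finsupp.mem_support_iff.1 hs, Finsupp.mem_support_iff.1 ht, e.symm⟩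

theorem mem_monoIdeal {T : Set S} {p : Alg k S} :
    p ∈ monoIdeal k T ↔ ∀ b, p.coeff b ≠ 0 → ∃ t ∈ T, ∃ s, b = s + t := by
  refine (AddMonoidAlgebra.mem_ideal_span_of'_image (s := T) (x := p)).trans ?_
  simp only [Finsupp.mem_support_iff]

theorem mono_mem_monoIdeal {T : Set S} {b : S} :
    mono k b ∈ monoIdeal k T ↔ ∃ t ∈ T, ∃ s, b = s + t := by
  rw [mem_monoIdeal]
  constructor
  · intro h
    exact h b (by simp [mono])
  · intro h c hc
    obtain rfl : b = c := by
      by_contra hne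
      exact hc (by simp [mono, hne])
    exact h

theorem mono_mem_monoIdeal_of_mem {T : Set S} {b : S} (hb : b ∈ T) : mono k b ∈ monoIdeal k T :=
  Ideal.subset_span ⟨b, hb, rfl⟩

theorem isMonomial_monoIdeal (T : Set S) : IsMonomial (monoIdeal k T) := fun _ hp b hb =>
  mono_mem_monoIdeal.2 (mem_monoIdeal.1 hp b hb)

theorem IsMonomial.eq_monoIdeal {J : Ideal (Alg k S)} (hJ : IsMonomial J) :
    J = monoIdeal k {b | mono k b ∈ J} := by
  apply le_antisymm
  · intro p hp
    exact mem_of_mono_mem fun b hb => mono_mem_monoIdeal_of_mem (hJ p hp b hb)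
  · rw [monoIdeal, Ideal.span_le]
    rintro _ ⟨b, hb, rfl⟩
    exact hb

theorem monoIdeal_union (T U : Set S) :
    monoIdeal k (T ∪ U) = monoIdeal k T ⊔ monoIdeal k U := by
  rw [monoIdeal, Set.image_union, Ideal.span_union, monoIdeal, monoIdeal]

theorem mono_mem_monoIdeal_sup {J : Ideal (Alg k S)} (hJ : IsMonomial J) {T : Set S} {b : S}
    (hb : mono k b ∈ monoIdeal k T ⊔ J) : mono k b ∈ J ∨ ∃ t ∈ T, ∃ s, b = s + t := by
  rw [hJ.eq_monoIdeal, ← monoIdeal_union] at hb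
  obtain ⟨t, ht | ht, s, rfl⟩ := mono_mem_monoIdeal.1 hb
  · exact Or.inr ⟨t, ht, s, rfl⟩
  · left
    rw [← mono_mul_mono]
    exact J.mul_mem_left _ ht

theorem isMonomial_bot : IsMonomial (⊥ : Ideal (Alg k S)) := by
  rintro p hp b hb
  rw [Ideal.mem_bot.1 hp] at hb
  simp at hb

theorem IsMonomial.iInf {ι : Sort*} {J : ι → Ideal (Alg k S)} (h : ∀ i, IsMonomial (J i)) :
    IsMonomial (⨅ i, J i) := by
  intro p hp b hb
  rw [Submodule.mem_iInf] at hp ⊢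
  exact fun i => h i p (hp i) b hb

open scoped Pointwise in
theorem IsMonomial.mul {I J : Ideal (Alg k S)} (hI : IsMonomial I) (hJ : IsMonomial J) :
    IsMonomial (I * J) := by
  rw [hI.eq_monoIdeal, hJ.eq_monoIdeal, monoIdeal, monoIdeal, Ideal.span_mul_span']
  have : mono k '' {b | mono k b ∈ I} * mono k '' {b | mono k b ∈ J} =
      mono k '' {b : S | ∃ s t, mono k s ∈ I ∧ mono k t ∈ J ∧ b = s + t} := by
    ext x
    constructor
    · rintro ⟨_, ⟨s, hs, rfl⟩, _, ⟨t, ht, rfl⟩, rfl⟩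
      exact ⟨s + t, ⟨s, t, hs, ht, rfl⟩, (mono_mul_mono s t).symm⟩
    · rintro ⟨_, ⟨s, t, hs, ht, rfl⟩, rfl⟩
      exact ⟨_, ⟨s, hs, rfl⟩, _, ⟨t, ht, rfl⟩, mono_mul_mono s t⟩
  rw [this]
  exact isMonomial_monoIdeal _

theorem IsMonomial.pow {I : Ideal (Alg k S)} (hI : IsMonomial I) (n : ℕ) :
    IsMonomial (I ^ n) := by
  induction n with
  | zero =>
    rw [pow_zero, Ideal.one_eq_top]
    exact fun _ _ _ _ => Submodule.mem_top
  | succ n ih => rw [pow_succ]; exact ih.mul hI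

/-- Colon ideals of monomial ideals are monomial: for x^s in I, the coefficient of x^s p at s + b is
that of p at b, so distinct terms of p cannot cancel. This lets annihilator conditions be tested on
single exponents. -/
theorem IsMonomial.mul_mono_mem {I J : Ideal (Alg k S)} (hI : IsMonomial I) (hJ : IsMonomial J)
    {p : Alg k S} (hp : ∀ r ∈ I, r * p ∈ J) {b : S} (hb : p.coeff b ≠ 0) :
    ∀ r ∈ I, r * mono k b ∈ J := by
  intro r hr
  refine mem_of_mono_mem fun c hc => ?_
  obtain ⟨s, t, hs, ht, rfl⟩ := coeff_mul_ne_zero hc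
  obtain rfl : b = t := by
    by_contra hne
    exact ht (by simp [mono, hne])
  exact hJ _ (hp _ (hI r hr s hs)) _ (by rwa [coeff_mono_mul])

theorem mem_kspan {T : Set S} {p : Alg k S} :
    p ∈ kspan k T ↔ ∀ b, p.coeff b ≠ 0 → b ∈ T := by
  constructor
  · intro hp
    induction hp using Submodule.span_induction with
    | mem x hx =>
      obtain ⟨t, ht, rfl⟩ := hx
      intro b hb
      obtain rfl : t = b := by
        by_contra hne
        exact hb (by simp [mono, hne])
      exact ht
    | zero => simp
    | add x y _ _ hx hy =>
      intro b hb
      by_cases h : x.coeff b = 0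
      · exact hy b fun h' => hb (by simp [h, h'])
      · exact hx b h
    | smul c x _ hx =>
      intro b hb
      exact hx b fun h => hb (by simp [h])
  · intro h
    rw [← p.sum_coeff_single]
    refine Submodule.sum_mem _ fun b hb => ?_
    have : AddMonoidAlgebra.single b (p.coeff b) = p.coeff b • mono k b := by simp [mono]
    rw [this]
    exact Submodule.smul_mem _ _
      (Submodule.subset_span ⟨b, h b (Finsupp.mem_support_iff.1 hb), rfl⟩)

/-- Multiply J by P until one more factor would push it into C; an element of the last product
outside C is killed by P modulo C. -/
theorem exists_mem_notMem_of_pow_mul_le {R : Type*} [CommRing R] {P C : Ideal R} (n : ℕ) :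
    ∀ {J : Ideal R}, P ^ n * J ≤ C → ¬ J ≤ C → ∃ p ∈ J, p ∉ C ∧ ∀ r ∈ P, r * p ∈ C := by
  induction n with
  | zero => exact fun hn hJ => absurd (by simpa using hn) hJ
  | succ n ih =>
    intro J hn hJ
    by_cases h : P * J ≤ C
    · obtain ⟨p, hp, hpC⟩ := SetLike.not_le_iff_exists.1 hJ
      exact ⟨p, hp, hpC, fun r hr => h (Ideal.mul_mem_mul hr hp)⟩
    · obtain ⟨p, hp, hpC⟩ := ih (by rwa [← mul_assoc, ← pow_succ]) h
      exact ⟨p, Ideal.mul_le_right hp, hpC⟩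

theorem exists_mem_notMem_of_pow_le {R : Type*} [CommRing R] {P J C : Ideal R} {n : ℕ}
    (hn : P ^ n ≤ C) (hJ : ¬ J ≤ C) : ∃ p ∈ J, p ∉ C ∧ ∀ r ∈ P, r * p ∈ C :=
  exists_mem_notMem_of_pow_mul_le n (Ideal.mul_le_left.trans hn) hJ

/-- Inherited from `ℤ^d`; it makes `k[S]` a domain. -/
instance : UniqueSums S :=
  UniqueSums.of_injective_addHom S.subtype.toAddHom Subtype.val_injective inferInstance

theorem alg_mul_ne_zero {p q : Alg k S} (hp : p ≠ 0) (hq : q ≠ 0) : p * q ≠ 0 :=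
  mul_ne_zero hp hq

theorem mono_ne_zero (b : S) : mono k b ≠ 0 := by
  simp [mono, AddMonoidAlgebra.single_eq_zero]

theorem isNoetherianRing_alg (hfg : S.FG) : IsNoetherianRing (Alg k S) := by
  have : AddMonoid.FG S := (AddMonoid.fg_iff_addSubmonoid_fg S).2 hfg
  exact Algebra.FiniteType.isNoetherianRing k _

end Monomial

/-! ### Homogeneous elements and generators in graded quotients -/

section Quotient

variable {k : Type*} [Field k] {d : ℕ} {Q : AddSubmonoid (Fin d → ℤ)}
  {M : Type*} [AddCommGroup M] [Module (Alg k Q) M]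

theorem HasDegree.mono_notMem {π : Alg k Q →ₗ[Alg k Q] M} {w : M} {b : Q}
    (h : HasDegree π w b) : mono k b ∉ LinearMap.ker π := by
  obtain ⟨hw, c, rfl⟩ := h
  exact fun hb => hw (single_mem_of_mono_mem hb c)

theorem HasDegree.ne_zero_of_eq {π : Alg k Q →ₗ[Alg k Q] M} {c : k} {b : Q}
    (h : π (AddMonoidAlgebra.single b c) ≠ 0) : c ≠ 0 := by
  rintro rfl
  simp at h

theorem hasDegree_map_mono {π : Alg k Q →ₗ[Alg k Q] M} {b : Q} (hb : π (mono k b) ≠ 0) :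
    HasDegree π (π (mono k b)) b :=
  ⟨hb, 1, rfl⟩

/-- The degree of a nonzero homogeneous element is unique. -/
theorem HasDegree.unique {π : Alg k Q →ₗ[Alg k Q] M} (hπ : IsMonomial (LinearMap.ker π))
    {w : M} {b c : Q} (hb : HasDegree π w b) (hc : HasDegree π w c) : b = c := by
  by_contra hne
  have hb' := hb.mono_notMem
  obtain ⟨hw, r, rfl⟩ := hb
  obtain ⟨_, s, hs⟩ := hc
  have hr : r ≠ 0 := HasDegree.ne_zero_of_eq hw
  refine hb' (hπ (AddMonoidAlgebra.single b r - AddMonoidAlgebra.single c s) ?_ b ?_)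
  · rw [LinearMap.mem_ker, map_sub, hs, sub_self]
  · simp [Ne.symm hne, hr]

theorem finite_degrees {π : Alg k Q →ₗ[Alg k Q] M} (hπ : IsMonomial (LinearMap.ker π))
    {G : Set M} (hG : G.Finite) : (degrees π G).Finite := by
  have : degrees π G = ⋃ g ∈ G, {b | HasDegree π g b} := by
    ext b
    simp [degrees]
  rw [this]
  exact hG.biUnion fun g _ => Set.Subsingleton.finite fun b hb c hc => hb.unique hπ hc

/-- Nonzero scalars are invertible, so dividing by homogeneous elements depends only on their
degrees. Hence B alone determines J. -/
theorem comap_span_eq (π : Alg k Q →ₗ[Alg k Q] M) {G : Set M}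
    (hG : ∀ g ∈ G, ∃ b, HasDegree π g b) :
    (Submodule.span (Alg k Q) G).comap π = monoIdeal k (degrees π G) ⊔ LinearMap.ker π := by
  rw [← Submodule.comap_map_eq]
  congr 1
  apply le_antisymm
  · rw [Submodule.span_le]
    intro g hg
    obtain ⟨b, hb⟩ := hG g hg
    have hmem : b ∈ degrees π G := ⟨g, hg, hb⟩
    obtain ⟨_, c, rfl⟩ := hb
    exact ⟨_, single_mem_of_mono_mem (mono_mem_monoIdeal_of_mem hmem) c, rfl⟩
  · rw [Submodule.map_le_iff_le_comap, monoIdeal, Ideal.span_le]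
    rintro _ ⟨b, ⟨g, hg, h0, c, rfl⟩, rfl⟩
    refine mono_mem_of_single_mem (J := (Submodule.span (Alg k Q) G).comap π)
      (HasDegree.ne_zero_of_eq h0) ?_
    exact Submodule.subset_span hg

theorem exists_isHomGenerators [IsNoetherianRing (Alg k Q)] {π : Alg k Q →ₗ[Alg k Q] M}
    (hπ : Function.Surjective π) (N : Submodule (Alg k Q) M) (hN : IsMonomial (N.comap π)) :
    ∃ G, IsHomGenerators π N G := by
  classical
  have hfg : (N.comap π).FG := IsNoetherian.noetherian _
  rw [IsMonomial.eq_monoIdeal hN, monoIdeal] at hfg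
  obtain ⟨t, ht, hspan⟩ := (Submodule.fg_span_iff_fg_span_finset_subset _).1 hfg
  -- Monomial generators upstairs may die in the quotient, and generators must be nonzero.
  refine ⟨π '' t \ {0}, (t.finite_toSet.image π).sdiff, ?_, ?_⟩
  · rintro _ ⟨⟨x, hx, rfl⟩, h0⟩
    obtain ⟨b, hb, rfl⟩ := ht hx
    exact ⟨b, hasDegree_map_mono h0⟩
  · rw [Submodule.span_sdiff_singleton_zero, ← Submodule.map_span, ← hspan]
    change Submodule.map π (monoIdeal k _) = N
    rw [← IsMonomial.eq_monoIdeal hN, Submodule.map_comap_eq_of_surjective hπ]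

theorem mem_comap_torsionBySet {I J : Ideal (Alg k Q)} {p : Alg k Q} :
    p ∈ (Submodule.torsionBySet (Alg k Q) (Alg k Q ⧸ J) (I : Set (Alg k Q))).comap J.mkQ ↔
      ∀ r ∈ I, r * p ∈ J := by
  simp only [Submodule.mem_comap, Submodule.mem_torsionBySet_iff, Subtype.forall, SetLike.mem_coe,
    Submodule.mkQ_apply]
  refine forall₂_congr fun r _ => ?_
  rw [← Submodule.Quotient.mk_smul, Submodule.Quotient.mk_eq_zero, smul_eq_mul]

theorem isMonomial_comap_torsionBySet {I J : Ideal (Alg k Q)} (hI : IsMonomial I)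
    (hJ : IsMonomial J) :
    IsMonomial ((Submodule.torsionBySet (Alg k Q) (Alg k Q ⧸ J)
      (I : Set (Alg k Q))).comap J.mkQ) := by
  intro p hp b hb
  rw [mem_comap_torsionBySet] at hp ⊢
  exact hI.mul_mono_mem hJ hp hb

theorem mem_comap_powerTorsion {I J : Ideal (Alg k Q)} {p : Alg k Q} :
    p ∈ (powerTorsion I (Alg k Q ⧸ J)).comap J.mkQ ↔ ∃ n : ℕ, ∀ r ∈ I ^ n, r * p ∈ J := by
  have hmono : Monotone fun n : ℕ => Submodule.torsionBySet (Alg k Q) (Alg k Q ⧸ J)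
      ((I ^ n : Ideal (Alg k Q)) : Set (Alg k Q)) := fun m n hmn =>
    Submodule.torsionBySet_le_torsionBySet_of_subset (Ideal.pow_le_pow_right hmn)
  rw [Submodule.mem_comap, powerTorsion, Submodule.mem_iSup_of_directed _ hmono.directed_le]
  exact exists_congr fun n => mem_comap_torsionBySet

theorem isMonomial_comap_powerTorsion {I J : Ideal (Alg k Q)} (hI : IsMonomial I)
    (hJ : IsMonomial J) : IsMonomial ((powerTorsion I (Alg k Q ⧸ J)).comap J.mkQ) := by
  intro p hp b hb
  rw [mem_comap_powerTorsion] at hp ⊢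
  obtain ⟨n, hn⟩ := hp
  exact ⟨n, (hI.pow n).mul_mono_mem hJ hn hb⟩

theorem killIdeal_eq {J : Ideal (Alg k Q)} {G : Set (Alg k Q ⧸ J)}
    (hG : ∀ g ∈ G, ∃ b, HasDegree J.mkQ g b) :
    killIdeal J G = monoIdeal k (degrees J.mkQ G) ⊔ J := by
  rw [killIdeal, comap_span_eq _ hG, Submodule.ker_mkQ]

theorem IsHomGenerators.mono_mem_comap {π : Alg k Q →ₗ[Alg k Q] M} {N : Submodule (Alg k Q) M}
    {G : Set M} (hG : IsHomGenerators π N G) {b : Q} (hb : b ∈ degrees π G) :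
    mono k b ∈ N.comap π := by
  obtain ⟨-, -, rfl⟩ := hG
  obtain ⟨g, hg, h0, c, rfl⟩ := hb
  exact mono_mem_of_single_mem (J := (Submodule.span (Alg k Q) G).comap π)
    (HasDegree.ne_zero_of_eq h0) (Submodule.subset_span hg)

end Quotient

/-! ### Faces of affine semigroups -/

section Face

variable {d : ℕ} {Q : AddSubmonoid (Fin d → ℤ)} {F : Set (Fin d → ℤ)}

/-- Comparing a minimizer f with 0 and with f + f shows that the minimum value is 0. -/
theorem IsFace.exists_functional (hF : IsFace Q F) :
    ∃ l : (Fin d → ℤ) →+ ℝ, (∀ q ∈ Q, 0 ≤ l q) ∧ ∀ q, q ∈ F ↔ q ∈ Q ∧ l q = 0 := by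
  obtain ⟨⟨f, hf⟩, l, rfl⟩ := hF
  have h0 : l f = 0 := by
    have h1 := hf.2 0 Q.zero_mem
    have h2 := hf.2 (f + f) (Q.add_mem hf.1 hf.1)
    rw [map_zero] at h1
    rw [map_add] at h2
    linarith
  refine ⟨l, fun q hq => h0 ▸ hf.2 q hq, fun q => ⟨fun hq => ⟨hq.1, ?_⟩, fun hq => ⟨hq.1, ?_⟩⟩⟩
  · exact le_antisymm (h0 ▸ hq.2 f hf.1) (h0 ▸ hf.2 q hq.1)
  · intro q' hq'
    rw [hq.2, ← h0]
    exact hf.2 q' hq'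

theorem IsFace.subset (hF : IsFace Q F) {q : Fin d → ℤ} (hq : q ∈ F) : q ∈ Q := by
  obtain ⟨l, -, h⟩ := hF.exists_functional
  exact ((h q).1 hq).1

theorem IsFace.zero_mem (hF : IsFace Q F) : 0 ∈ F := by
  obtain ⟨l, -, h⟩ := hF.exists_functional
  exact (h 0).2 ⟨Q.zero_mem, map_zero l⟩

theorem IsFace.add_mem (hF : IsFace Q F) {p q : Fin d → ℤ} (hp : p ∈ F) (hq : q ∈ F) :
    p + q ∈ F := by
  obtain ⟨l, -, h⟩ := hF.exists_functional
  rw [h] at *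
  exact ⟨Q.add_mem hp.1 hq.1, by rw [map_add, hp.2, hq.2, add_zero]⟩

theorem IsFace.left_mem_of_add_mem (hF : IsFace Q F) {p q : Fin d → ℤ} (hp : p ∈ Q) (hq : q ∈ Q)
    (hpq : p + q ∈ F) : p ∈ F := by
  obtain ⟨l, hl, h⟩ := hF.exists_functional
  rw [h] at *
  refine ⟨hp, ?_⟩
  have := hpq.2
  rw [map_add] at this
  linarith [hl p hp, hl q hq]

theorem IsFace.right_mem_of_add_mem (hF : IsFace Q F) {p q : Fin d → ℤ} (hp : p ∈ Q)
    (hq : q ∈ Q) (hpq : p + q ∈ F) : q ∈ F :=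
  hF.left_mem_of_add_mem hq hp (add_comm p q ▸ hpq)

theorem IsFace.nsmul_mem (hF : IsFace Q F) {q : Fin d → ℤ} (hq : q ∈ F) (n : ℕ) :
    n • q ∈ F := by
  induction n with
  | zero => simpa using hF.zero_mem
  | succ n ih => rw [succ_nsmul]; exact hF.add_mem ih hq

theorem IsFace.exists_sub_of_mem_closure (hF : IsFace Q F) {x : Fin d → ℤ}
    (hx : x ∈ AddSubgroup.closure F) : ∃ f ∈ F, ∃ g ∈ F, x = f - g := by
  induction hx using AddSubgroup.closure_induction with
  | mem x hx => exact ⟨x, hx, 0, hF.zero_mem, by simp⟩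
  | zero => exact ⟨0, hF.zero_mem, 0, hF.zero_mem, by simp⟩
  | add x y _ _ hx hy =>
    obtain ⟨f, hf, g, hg, rfl⟩ := hx
    obtain ⟨f', hf', g', hg', rfl⟩ := hy
    exact ⟨f + f', hF.add_mem hf hf', g + g', hF.add_mem hg hg', by abel⟩
  | neg x _ hx =>
    obtain ⟨f, hf, g, hg, rfl⟩ := hx
    exact ⟨g, hg, f, hf, by abel⟩

/-- A face of a finitely generated monoid has a point that lies in none of its facets. -/
theorem IsFace.exists_mem_forall_isFacetOf (hfg : Q.FG) (hF : IsFace Q F) :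
    ∃ q ∈ F, ∀ D, IsFacetOf Q D F → q ∉ D := by
  classical
  obtain ⟨A, rfl⟩ := hfg
  set Q := AddSubmonoid.closure (A : Set (Fin d → ℤ))
  set A' := A.filter (· ∈ F)
  have hA : ∀ x ∈ A, x ∈ Q := fun x hx => AddSubmonoid.subset_closure hx
  have hsum : ∀ B : Finset (Fin d → ℤ), B ⊆ A' → ∑ x ∈ B, x ∈ F := by
    intro B
    induction B using Finset.induction_on with
    | empty => intro _; simpa using hF.zero_mem
    | insert x B hx ih =>
      intro hB
      rw [Finset.sum_insert hx]
      exact hF.add_mem (Finset.mem_filter.1 (hB (Finset.mem_insert_self x B))).2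
        (ih fun y hy => hB (Finset.mem_insert_of_mem hy))
  -- The sum of the generators lying in F: a face D containing it contains each summand, hence all
  -- of F, which contradicts the dimension drop.
  refine ⟨∑ x ∈ A', x, hsum A' subset_rfl, ?_⟩
  rintro D ⟨hD, hDF, hdim⟩ hmem
  have hgen : ∀ x ∈ A', x ∈ D := by
    intro x hx
    rw [← Finset.add_sum_erase _ _ hx] at hmem
    exact hD.left_mem_of_add_mem (hA x (Finset.mem_filter.1 hx).1)
      (hF.subset (hsum _ (Finset.erase_subset x A'))) hmem
  have hFD : ∀ q ∈ Q, q ∈ F → q ∈ D := by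
    intro q hq
    induction hq using AddSubmonoid.closure_induction with
    | mem x hx => exact fun hxF => hgen x (Finset.mem_filter.2 ⟨hx, hxF⟩)
    | zero => exact fun _ => hD.zero_mem
    | add x y hx hy ihx ihy =>
      exact fun h => hD.add_mem (ihx (hF.left_mem_of_add_mem hx hy h))
        (ihy (hF.right_mem_of_add_mem hx hy h))
  have : D = F := hDF.antisymm fun q hq => hFD q (hF.subset hq) hq
  subst this
  omega

/-- A functional cutting out a face of a finitely generated monoid is bounded away from `0` off
the face. -/
theorem exists_pos_le_of_fg (hfg : Q.FG) {l : (Fin d → ℤ) →+ ℝ} (hl : ∀ q ∈ Q, 0 ≤ l q) :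
    ∃ ε > 0, ∀ q ∈ Q, l q = 0 ∨ ε ≤ l q := by
  classical
  obtain ⟨A, rfl⟩ := hfg
  obtain ⟨ε, hε, h⟩ : ∃ ε > 0, ∀ x ∈ A, l x = 0 ∨ ε ≤ l x := by
    have hA : ∀ x ∈ A, 0 ≤ l x := fun x hx => hl x (AddSubmonoid.subset_closure hx)
    clear hl
    induction A using Finset.induction_on with
    | empty => exact ⟨1, one_pos, by simp⟩
    | insert x A _ ih =>
      obtain ⟨ε, hε, h⟩ := ih fun y hy => hA y (Finset.mem_insert_of_mem hy)
      rcases (hA x (Finset.mem_insert_self x A)).eq_or_lt with hx | hx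
      · refine ⟨ε, hε, fun y hy => ?_⟩
        rcases Finset.mem_insert.1 hy with rfl | hy
        · exact Or.inl hx.symm
        · exact h y hy
      · refine ⟨min ε (l x), lt_min hε hx, fun y hy => ?_⟩
        rcases Finset.mem_insert.1 hy with rfl | hy
        · exact Or.inr (min_le_right _ _)
        · exact (h y hy).imp_right (min_le_left _ _).trans
  refine ⟨ε, hε, fun q hq => ?_⟩
  induction hq using AddSubmonoid.closure_induction with
  | mem x hx => exact h x hx
  | zero => exact Or.inl (map_zero l)
  | add x y hx hy ihx ihy =>
    rw [map_add]
    have hx0 := hl x hx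
    have hy0 := hl y hy
    rcases ihx with hx' | hx'
    · rw [hx', zero_add]
      exact ihy
    · exact Or.inr (by linarith)

end Face

/-! ### The target ideal, the starting ideal, and irreducibility -/

section Cut

variable {k : Type*} [Field k] {d : ℕ} {Q : AddSubmonoid (Fin d → ℤ)} {F : Set (Fin d → ℤ)}
  {a : Fin d → ℤ}

theorem mem_cut {S : AddSubmonoid (Fin d → ℤ)} {b : S} :
    b ∈ cut S F a ↔ (b : Fin d → ℤ) ∉ translate a F S :=
  Iff.rfl

theorem add_mem_cut {S : AddSubmonoid (Fin d → ℤ)} {b : S} (hb : b ∈ cut S F a) (s : S) :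
    s + b ∈ cut S F a := by
  rintro ⟨f, hf, t, ht, h⟩
  refine hb ⟨f, hf, t + s, S.add_mem ht s.2, ?_⟩
  rw [AddSubmonoid.coe_add] at h
  rw [← sub_sub, ← h, add_sub_cancel_left]

theorem mono_mem_monoIdeal_cut {S : AddSubmonoid (Fin d → ℤ)} {b : S} :
    mono k b ∈ monoIdeal k (cut S F a) ↔ b ∈ cut S F a := by
  refine ⟨fun h => ?_, mono_mem_monoIdeal_of_mem⟩
  obtain ⟨t, ht, s, rfl⟩ := mono_mem_monoIdeal.1 h
  exact add_mem_cut ht s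

theorem add_mem_translate {S : AddSubmonoid (Fin d → ℤ)} {f : Fin d → ℤ} (hf : f ∈ F) :
    a + f ∈ translate a F S :=
  ⟨f, hf, 0, S.zero_mem, (sub_zero _).symm⟩

theorem translate_mono {S S' : AddSubmonoid (Fin d → ℤ)} (h : S ≤ S') :
    translate a F S ⊆ translate a F S' := by
  rintro x ⟨f, hf, s, hs, rfl⟩
  exact ⟨f, hf, s, h hs, rfl⟩

theorem mem_startIdeal {p : Alg k Q} :
    p ∈ startIdeal k Q F a ↔
      ∀ b, p.coeff b ≠ 0 → (b : Fin d → ℤ) ∉ translate a F (saturation Q) := by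
  have hinj : Function.Injective (AddSubmonoid.inclusion (le_saturation Q)) :=
    AddSubmonoid.inclusion_injective _
  have hcut : ∀ b : saturation Q, mono k b ∈ satIdeal k Q F a ↔ b ∈ cut (saturation Q) F a :=
    fun _ => mono_mem_monoIdeal_cut
  rw [startIdeal, Ideal.mem_comap]
  constructor
  · intro h b hb
    refine (hcut (AddSubmonoid.inclusion (le_saturation Q) b)).1 (isMonomial_monoIdeal _ _ h _ ?_)
    simpa [AddMonoidAlgebra.mapDomainRingHom_apply, Finsupp.mapDomain_apply hinj] using hb
  · intro h
    rw [← p.sum_coeff_single, Finsupp.sum, map_sum]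
    refine Ideal.sum_mem _ fun b hb => ?_
    simp only [AddMonoidAlgebra.mapDomainRingHom_apply, AddMonoidAlgebra.mapDomain_single]
    exact single_mem_of_mono_mem ((hcut _).2 (h b (Finsupp.mem_support_iff.1 hb))) _

theorem isMonomial_startIdeal : IsMonomial (startIdeal k Q F a) := by
  intro p hp b hb
  rw [mem_startIdeal] at hp ⊢
  intro c hc
  obtain rfl : b = c := by
    by_contra hne
    exact hc (by simp [mono, hne])
  exact hp b hb

theorem startIdeal_le : startIdeal k Q F a ≤ monoIdeal k (cut Q F a) := fun _ hp =>
  mem_of_mono_mem fun b hb => mono_mem_monoIdeal_cut.2 fun h =>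
    mem_startIdeal.1 hp b hb (translate_mono (le_saturation Q) h)

theorem isMonomial_facePrime : IsMonomial (facePrime k Q F) :=
  isMonomial_monoIdeal _

theorem mono_mem_facePrime {b : Q} (hb : (b : Fin d → ℤ) ∉ F) : mono k b ∈ facePrime k Q F :=
  mono_mem_monoIdeal_of_mem hb

theorem isMonomial_facetIdeal : IsMonomial (facetIdeal k Q F) :=
  IsMonomial.iInf fun _ => IsMonomial.iInf fun _ => isMonomial_facePrime

/-- On exponents occurring in P_F^n, a functional defining F is at least nε, while on a + F - Q^sat
it is at most its value at a. -/
theorem facePrime_pow_le (hfg : Q.FG) (hF : IsFace Q F) :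
    ∃ n, facePrime k Q F ^ n ≤ startIdeal k Q F a := by
  obtain ⟨l, hl, hlF⟩ := hF.exists_functional
  obtain ⟨ε, hε, hgap⟩ := exists_pos_le_of_fg hfg hl
  have hP : ∀ p ∈ facePrime k Q F, ∀ b, p.coeff b ≠ 0 → ε ≤ l b := by
    intro p hp b hb
    obtain ⟨t, ht, s, rfl⟩ := mem_monoIdeal.1 hp b hb
    have ht' : ε ≤ l t := (hgap t t.2).resolve_left fun h => ht ((hlF t).2 ⟨t.2, h⟩)
    rw [AddSubmonoid.coe_add, map_add]
    linarith [hl s s.2]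
  have hpow : ∀ n : ℕ, ∀ p ∈ facePrime k Q F ^ n, ∀ b, p.coeff b ≠ 0 → n * ε ≤ l b := by
    intro n
    induction n with
    | zero =>
      intro p _ b _
      simpa using hl b b.2
    | succ n ih =>
      intro p hp
      rw [pow_succ] at hp
      induction hp using Submodule.mul_induction_on' with
      | mem_mul_mem x hx y hy =>
        intro b hb
        obtain ⟨s, t, hs, ht, rfl⟩ := coeff_mul_ne_zero hb
        rw [AddSubmonoid.coe_add, map_add, Nat.cast_succ]
        linarith [ih x hx s hs, hP y hy t ht]
      | add x _ y _ hx hy =>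
        intro b hb
        by_cases h : x.coeff b = 0
        · exact hy b fun h' => hb (by simp [h, h'])
        · exact hx b h
  have hsat : ∀ s ∈ saturation Q, 0 ≤ l s := by
    rintro s ⟨n, hn, hs⟩
    have := hl _ hs
    rw [map_nsmul, nsmul_eq_mul] at this
    exact nonneg_of_mul_nonneg_right this (Nat.cast_pos.2 hn)
  obtain ⟨n, hn⟩ := exists_nat_gt (l a / ε)
  refine ⟨n, fun p hp => mem_startIdeal.2 ?_⟩
  rintro b hb ⟨f, hf, s, hs, h⟩
  have h1 := hpow n p hp b hb
  rw [h, map_sub, map_add, ((hlF f).1 hf).2] at h1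
  rw [div_lt_iff₀ hε] at hn
  linarith [hsat s hs]

/-- The monomials that survive modulo `k{Q ∖ (a + F - Q)}` and are killed by `P_F` have degree
in `a + F - F`. -/
theorem exists_add_eq_of_notMem_cut {b : Q} (hb : b ∉ cut Q F a)
    (hP : ∀ q : Q, (q : Fin d → ℤ) ∉ F → q + b ∈ cut Q F a) :
    ∃ f ∈ F, ∃ g ∈ F, (b : Fin d → ℤ) + g = a + f := by
  obtain ⟨f, hf, s, hs, h⟩ := not_not.1 hb
  have hbs : (b : Fin d → ℤ) + s = a + f := by rw [h, sub_add_cancel]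
  refine ⟨f, hf, s, ?_, hbs⟩
  by_contra hsF
  -- If s were outside F, adding s to b would have to leave a + F - Q, yet s + b = a + f.
  refine hP ⟨s, hs⟩ hsF ?_
  rw [AddSubmonoid.coe_add, add_comm, hbs]
  exact add_mem_translate hf

theorem mem_translate_of_sub_mem_closure (hF : IsFace Q F) {b : Fin d → ℤ}
    (hb : b - a ∈ AddSubgroup.closure F) : b ∈ translate a F Q := by
  obtain ⟨f, hf, g, hg, h⟩ := hF.exists_sub_of_mem_closure hb
  exact ⟨f, hf, g, hF.subset hg, by rw [add_sub_assoc, ← h, add_sub_cancel]⟩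

/-- Keeps the first half of the loop inside the target ideal. -/
theorem mem_cut_of_facePrime_mul_mem {b : Q}
    (hP : ∀ r ∈ facePrime k Q F, r * mono k b ∈ monoIdeal k (cut Q F a))
    (hb : (b : Fin d → ℤ) - a ∉ AddSubgroup.closure F) : b ∈ cut Q F a := by
  by_contra hcut
  obtain ⟨f, hf, g, hg, h⟩ := exists_add_eq_of_notMem_cut hcut fun q hq => by
    have := hP _ (mono_mem_facePrime hq)
    rwa [mono_mul_mono, mono_mem_monoIdeal_cut] at this
  refine hb ?_
  rw [show (b : Fin d → ℤ) - a = f - g by rw [sub_eq_sub_iff_add_eq_add, h, add_comm]]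
  exact sub_mem (AddSubgroup.subset_closure hf) (AddSubgroup.subset_closure hg)

/-- Keeps the Γ_I half inside the target ideal: a + F - Q is stable under adding a point of F that
avoids all facets, whose monomial lies in I. -/
theorem mem_cut_of_facetIdeal_pow_mul_mem (hfg : Q.FG) (hF : IsFace Q F) {b : Q} {n : ℕ}
    (hI : ∀ r ∈ facetIdeal k Q F ^ n, r * mono k b ∈ monoIdeal k (cut Q F a)) :
    b ∈ cut Q F a := by
  obtain ⟨q, hq, hqD⟩ := hF.exists_mem_forall_isFacetOf hfg
  have hmem : mono k (⟨q, hF.subset hq⟩ : Q) ∈ facetIdeal k Q F := by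
    simp only [facetIdeal, Submodule.mem_iInf]
    exact fun D hD => mono_mem_facePrime (hqD D hD)
  have hpow : ∀ m : ℕ, mono k (⟨q, hF.subset hq⟩ : Q) ^ m = mono k (m • ⟨q, hF.subset hq⟩ : Q) := by
    intro m
    simp [mono, AddMonoidAlgebra.single_pow]
  have := hI _ (Ideal.pow_mem_pow hmem n)
  rw [hpow, mono_mul_mono, mono_mem_monoIdeal_cut] at this
  rintro ⟨f, hf, s, hs, h⟩
  refine this ⟨f + n • q, hF.add_mem hf (hF.nsmul_mem hq n), s, hs, ?_⟩
  rw [AddSubmonoid.coe_add, h]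
  simp only [AddSubmonoidClass.coe_nsmul]
  abel

theorem mul_mem_kspan_face (hF : IsFace Q F) {p q : Alg k Q}
    (hp : p ∈ kspan k {b : Q | (b : Fin d → ℤ) ∈ F})
    (hq : q ∈ kspan k {b : Q | (b : Fin d → ℤ) ∈ F}) :
    p * q ∈ kspan k {b : Q | (b : Fin d → ℤ) ∈ F} := by
  rw [mem_kspan] at *
  intro b hb
  obtain ⟨s, t, hs, ht, rfl⟩ := coeff_mul_ne_zero hb
  exact hF.add_mem (hp s hs) (hq t ht)

/-- Clearing denominators: exponents in a + F - F move into a + F after multiplication by one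
monomial of F. -/
theorem exists_mono_mul_eq (hF : IsFace Q F) {a : Q} {p : Alg k Q}
    (hp : p ∈ kspan k {b : Q | ∃ f ∈ F, ∃ g ∈ F, (b : Fin d → ℤ) + g = a + f}) :
    ∃ g : Q, (g : Fin d → ℤ) ∈ F ∧ ∃ r ∈ kspan k {b : Q | (b : Fin d → ℤ) ∈ F},
      mono k g * p = mono k a * r := by
  have hmono : ∀ f : Q, (f : Fin d → ℤ) ∈ F →
      mono k f ∈ kspan k {b : Q | (b : Fin d → ℤ) ∈ F} :=
    fun f hf => Submodule.subset_span ⟨f, hf, rfl⟩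
  induction hp using Submodule.span_induction with
  | mem x hx =>
    obtain ⟨b, ⟨f, hf, g, hg, h⟩, rfl⟩ := hx
    refine ⟨⟨g, hF.subset hg⟩, hg, mono k ⟨f, hF.subset hf⟩, hmono _ hf, ?_⟩
    rw [mono_mul_mono, mono_mul_mono]
    congr 1
    ext1
    rw [AddSubmonoid.coe_add, AddSubmonoid.coe_add, add_comm, h]
  | zero => exact ⟨0, hF.zero_mem, 0, zero_mem _, by simp⟩
  | add x y _ _ hx hy =>
    obtain ⟨g, hg, r, hr, h⟩ := hx
    obtain ⟨g', hg', r', hr', h'⟩ := hy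
    refine ⟨g + g', hF.add_mem hg hg', mono k g' * r + mono k g * r',
      add_mem (mul_mem_kspan_face hF (hmono g' hg') hr)
        (mul_mem_kspan_face hF (hmono g hg) hr'), ?_⟩
    rw [← mono_mul_mono]
    linear_combination mono k g' * h + mono k g * h'
  | smul c x _ hx =>
    obtain ⟨g, hg, r, hr, h⟩ := hx
    exact ⟨g, hg, c • r, Submodule.smul_mem _ _ hr, by rw [mul_smul_comm, h, mul_smul_comm]⟩

/-- Every ideal that properly contains `k{Q ∖ (a + F - Q)}` has a nonzero element in
`x^a k[F]`. -/
theorem exists_mono_mul_mem (hfg : Q.FG) (hF : IsFace Q F) {a : Q} {I : Ideal (Alg k Q)}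
    (hI : monoIdeal k (cut Q F a) < I) :
    ∃ r ∈ kspan k {b : Q | (b : Fin d → ℤ) ∈ F}, r ≠ 0 ∧ mono k a * r ∈ I := by
  set C := monoIdeal k (cut Q F (a : Fin d → ℤ))
  obtain ⟨n, hn⟩ := facePrime_pow_le (k := k) (a := (a : Fin d → ℤ)) hfg hF
  obtain ⟨p, hpI, hpC, hP⟩ :=
    exists_mem_notMem_of_pow_le (hn.trans startIdeal_le) (not_le_of_gt hI)
  -- Modulo C, only terms with exponents in a + F - F survive in an element killed by P_F; the
  -- C-part can then be discarded.
  have hsplit : p ∈ C.restrictScalars k ⊔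
      kspan k {b : Q | ∃ f ∈ F, ∃ g ∈ F, (b : Fin d → ℤ) + g = a + f} := by
    rw [← p.sum_coeff_single]
    refine Submodule.sum_mem _ fun b hb => ?_
    by_cases hbC : b ∈ cut Q F (a : Fin d → ℤ)
    · exact Submodule.mem_sup_left (single_mem_of_mono_mem (mono_mem_monoIdeal_of_mem hbC) _)
    · refine Submodule.mem_sup_right ?_
      have : AddMonoidAlgebra.single b (p.coeff b) = p.coeff b • mono k b := by simp [mono]
      rw [this]
      refine Submodule.smul_mem _ _ (Submodule.subset_span ⟨b, ?_, rfl⟩)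
      refine exists_add_eq_of_notMem_cut hbC fun q hq => ?_
      have := isMonomial_facePrime.mul_mono_mem (isMonomial_monoIdeal _) hP
        (Finsupp.mem_support_iff.1 hb) _ (mono_mem_facePrime hq)
      rwa [mono_mul_mono, mono_mem_monoIdeal_cut] at this
  obtain ⟨c, hc, t, ht, rfl⟩ := Submodule.mem_sup.1 hsplit
  have hcC : c ∈ C := hc
  have htC : t ∉ C := fun h => hpC (C.add_mem hcC h)
  have htI : t ∈ I := (I.add_mem_iff_right (hI.le hcC)).1 hpI
  obtain ⟨g, -, r, hr, h⟩ := exists_mono_mul_eq hF ht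
  refine ⟨r, hr, ?_, h ▸ I.mul_mem_left _ htI⟩
  rintro rfl
  rw [mul_zero] at h
  exact alg_mul_ne_zero (mono_ne_zero g) (fun h0 : t = 0 => htC (h0 ▸ C.zero_mem)) h

theorem infIrred_monoIdeal_cut (hfg : Q.FG) (hF : IsFace Q F) (ha : a ∈ Q) :
    InfIrred (monoIdeal k (cut Q F a)) := by
  lift a to Q using ha
  constructor
  · rw [isMax_iff_eq_top, Ideal.eq_top_iff_one]
    have : (1 : Alg k Q) = mono k 0 := rfl
    rw [this, mono_mem_monoIdeal_cut]
    -- Proper because 0 = a + 0 - a.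
    exact fun h => h ⟨0, hF.zero_mem, a, a.2, by simp⟩
  · intro I J hIJ
    by_contra! hne
    have hI : monoIdeal k (cut Q F (a : Fin d → ℤ)) < I :=
      lt_of_le_of_ne (hIJ ▸ inf_le_left) hne.1.symm
    have hJ : monoIdeal k (cut Q F (a : Fin d → ℤ)) < J :=
      lt_of_le_of_ne (hIJ ▸ inf_le_right) hne.2.symm
    obtain ⟨r, hr, hr0, hrI⟩ := exists_mono_mul_mem hfg hF hI
    obtain ⟨s, hs, hs0, hsJ⟩ := exists_mono_mul_mem hfg hF hJ
    -- A single factor x^a suffices, so the exponents stay in a + F, outside the cut.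
    have hmem : mono k a * (r * s) ∈ I ⊓ J := by
      refine ⟨?_, ?_⟩
      · rw [← mul_assoc]
        exact I.mul_mem_right _ hrI
      · rw [mul_left_comm]
        exact J.mul_mem_left _ hsJ
    rw [hIJ] at hmem
    have hrs := mul_mem_kspan_face hF hr hs
    have hne0 := alg_mul_ne_zero hr0 hs0
    obtain ⟨b, hb⟩ : ∃ b, (r * s).coeff b ≠ 0 := by
      by_contra! h
      refine hne0 ?_
      ext b
      simpa using h b
    have hab := isMonomial_monoIdeal _ _ hmem (a + b) (by rwa [coeff_mono_mul])
    rw [mono_mem_monoIdeal_cut] at hab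
    exact hab (add_mem_translate (mem_kspan.1 hrs b hb))

end Cut

/-! ### Loop invariant, correctness at exit, and termination -/

section Algorithm

variable {k : Type*} [Field k] {d : ℕ} {Q : AddSubmonoid (Fin d → ℤ)} {F : Set (Fin d → ℤ)}
  {a : Fin d → ℤ}

/-- The loop invariant: `J = ⟨x^b | b ∈ B⟩` lies between `W` and `k{Q ∖ (a + F - Q)}`, and it
reaches the latter when the algorithm ends. -/
structure Invariant (F : Set (Fin d → ℤ)) (a : Fin d → ℤ) (s : State k Q) : Prop where
  finite : s.B.Finite
  eq_monoIdeal : s.J = monoIdeal k s.B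
  startIdeal_le : startIdeal k Q F a ≤ s.J
  le_cut : s.J ≤ monoIdeal k (cut Q F a)
  cut_le : s.stage = Stage.done → monoIdeal k (cut Q F a) ≤ s.J

theorem Invariant.isMonomial {s : State k Q} (hs : Invariant F a s) : IsMonomial s.J :=
  hs.eq_monoIdeal ▸ isMonomial_monoIdeal _

theorem Initial.invariant {s : State k Q} (hs : Initial k Q F a s) : Invariant F a s := by
  obtain ⟨G, ⟨hfin, hhom, hspan⟩, rfl⟩ := hs
  have hker : IsMonomial (LinearMap.ker (LinearMap.id : Alg k Q →ₗ[Alg k Q] Alg k Q)) := by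
    rw [LinearMap.ker_id]
    exact isMonomial_bot
  refine ⟨finite_degrees hker hfin, ?_, le_rfl, startIdeal_le, fun h => nomatch h⟩
  have := comap_span_eq LinearMap.id hhom
  rwa [hspan, LinearMap.ker_id, sup_bot_eq, Submodule.comap_id] at this

theorem Invariant.of_killIdeal {st st' : Stage} {B : Set Q} {J : Ideal (Alg k Q)}
    (hs : Invariant F a ⟨st, B, J⟩) (hst : st' ≠ Stage.done) {G : Set (Alg k Q ⧸ J)}
    (hfin : G.Finite) (hhom : ∀ g ∈ G, ∃ b, HasDegree J.mkQ g b)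
    (hcut : degrees J.mkQ G ⊆ cut Q F a) :
    Invariant F a ⟨st', B ∪ degrees J.mkQ G, killIdeal J G⟩ := by
  have hmon : IsMonomial (LinearMap.ker J.mkQ) := by
    rw [Submodule.ker_mkQ]
    exact hs.isMonomial
  have hJ : J = monoIdeal k B := hs.eq_monoIdeal
  refine ⟨hs.finite.union (finite_degrees hmon hfin), ?_, ?_, ?_, fun h => absurd h hst⟩
  · change killIdeal J G = _
    rw [killIdeal_eq hhom, monoIdeal_union, ← hJ, sup_comm]
  · change _ ≤ killIdeal J G
    rw [killIdeal_eq hhom]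
    exact hs.startIdeal_le.trans le_sup_right
  · change killIdeal J G ≤ _
    rw [killIdeal_eq hhom]
    exact sup_le (Ideal.span_mono (Set.image_mono hcut)) hs.le_cut

/-- Needs uniqueness of degrees: being off-degree is witnessed by one degree of g, possibly a
different one a priori. -/
theorem mem_offDegree_degrees {J : Ideal (Alg k Q)} (hJ : IsMonomial J) {H : Set (Alg k Q ⧸ J)}
    {b : Q} (hb : b ∈ degrees J.mkQ (offDegree J.mkQ F a H)) :
    b ∈ degrees J.mkQ H ∧ (b : Fin d → ℤ) - a ∉ AddSubgroup.closure F := by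
  obtain ⟨g, ⟨hg, c, hc, hca⟩, hgb⟩ := hb
  obtain rfl : b = c := hgb.unique (by rwa [Submodule.ker_mkQ]) hc
  exact ⟨⟨g, hg, hgb⟩, hca⟩

/-- The socle argument at exit: a monomial of the target ideal missing from J can be chosen to be
killed by P_F modulo J, and the generators then force its degree to be ≡ a mod ℤF. -/
theorem le_of_offDegree_eq_empty (hfg : Q.FG) (hF : IsFace Q F) {J : Ideal (Alg k Q)}
    (hJ : IsMonomial J) (hW : startIdeal k Q F a ≤ J) {H : Set (Alg k Q ⧸ J)}
    (hH : IsHomGenerators J.mkQ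
      (Submodule.torsionBySet (Alg k Q) (Alg k Q ⧸ J) (facePrime k Q F : Set (Alg k Q))) H)
    (hoff : offDegree J.mkQ F a H = ∅) : monoIdeal k (cut Q F a) ≤ J := by
  by_contra hle
  obtain ⟨n, hn⟩ := facePrime_pow_le (k := k) (a := a) hfg hF
  obtain ⟨p, hp, hpJ, hP⟩ := exists_mem_notMem_of_pow_le (hn.trans hW) hle
  obtain ⟨b, hb, hbJ⟩ : ∃ b, p.coeff b ≠ 0 ∧ mono k b ∉ J := by
    by_contra! h
    exact hpJ (mem_of_mono_mem h)
  have hbcut : b ∈ cut Q F a :=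
    mono_mem_monoIdeal_cut.1 (isMonomial_monoIdeal _ p hp b hb)
  have hbP := isMonomial_facePrime.mul_mono_mem hJ hP hb
  have hmem : mono k b ∈ killIdeal J H := by
    rw [killIdeal, hH.2.2]
    exact mem_comap_torsionBySet.2 hbP
  rw [killIdeal_eq hH.2.1] at hmem
  obtain ⟨t, ⟨g, hg, hgt⟩, q, rfl⟩ := (mono_mem_monoIdeal_sup hJ hmem).resolve_left hbJ
  have hta : (t : Fin d → ℤ) - a ∈ AddSubgroup.closure F := by
    by_contra h
    have : g ∈ offDegree J.mkQ F a H := ⟨hg, t, hgt, h⟩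
    rw [hoff] at this
    exact this
  have htP := mem_comap_torsionBySet.1
    (hH.mono_mem_comap ⟨g, hg, hgt⟩)
  -- Otherwise x^q ∈ P_F would kill the generator x^t, putting x^b in J.
  have hqF : (q : Fin d → ℤ) ∈ F := by
    by_contra hq
    have := htP _ (mono_mem_facePrime hq)
    rw [mono_mul_mono] at this
    exact hbJ this
  refine hbcut (mem_translate_of_sub_mem_closure hF ?_)
  rw [AddSubmonoid.coe_add, add_sub_assoc]
  exact add_mem (AddSubgroup.subset_closure hqF) hta

theorem Step.invariant (hfg : Q.FG) (hF : IsFace Q F) {s t : State k Q}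
    (hst : Step k Q F a s t) (hs : Invariant F a s) : Invariant F a t := by
  cases hst with
  | exit B J H hH hoff =>
    refine ⟨hs.finite, hs.eq_monoIdeal, hs.startIdeal_le, hs.le_cut, fun _ => ?_⟩
    exact le_of_offDegree_eq_empty hfg hF hs.isMonomial hs.startIdeal_le hH hoff
  | strip B J H hH hoff =>
    have hJ : IsMonomial J := hs.isMonomial
    refine hs.of_killIdeal (show Stage.body ≠ Stage.done from nofun) (hH.1.subset fun g hg => hg.1)
      (fun g hg => hH.2.1 g hg.1) ?_
    intro b hb
    obtain ⟨hb, hba⟩ := mem_offDegree_degrees hJ hb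
    have hbP := mem_comap_torsionBySet.1
      (hH.mono_mem_comap hb)
    exact mem_cut_of_facePrime_mul_mem (fun r hr => hs.le_cut (hbP r hr)) hba
  | torsion B J G hG =>
    refine hs.of_killIdeal (show Stage.test ≠ Stage.done from nofun) hG.1 hG.2.1 ?_
    intro b hb
    obtain ⟨n, hn⟩ := mem_comap_powerTorsion.1
      (hG.mono_mem_comap hb)
    exact mem_cut_of_facetIdeal_pow_mul_mem hfg hF fun r hr => hs.le_cut (hn r hr)

theorem Reachable.invariant (hfg : Q.FG) (hF : IsFace Q F) {s : State k Q}
    (hs : Reachable k Q F a s) : Invariant F a s := by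
  obtain ⟨s₀, h₀, h⟩ := hs
  induction h with
  | refl => exact h₀.invariant
  | tail _ hst ih => exact hst.invariant hfg hF ih

theorem exists_initial (hfg : Q.FG) : ∃ s, Initial k Q F a s := by
  have := isNoetherianRing_alg (k := k) hfg
  obtain ⟨G, hG⟩ := exists_isHomGenerators (π := (LinearMap.id : Alg k Q →ₗ[Alg k Q] Alg k Q))
    Function.surjective_id (startIdeal k Q F a)
    (by rw [Submodule.comap_id]; exact isMonomial_startIdeal)
  exact ⟨_, G, hG, rfl⟩

theorem exists_step (hfg : Q.FG) {s : State k Q} (hs : IsMonomial s.J) :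
    s.stage = Stage.done ∨ ∃ t, Step k Q F a s t := by
  have := isNoetherianRing_alg (k := k) hfg
  obtain ⟨st, B, J⟩ := s
  cases st with
  | test =>
    obtain ⟨H, hH⟩ := exists_isHomGenerators J.mkQ_surjective _
      (isMonomial_comap_torsionBySet (isMonomial_facePrime (F := F)) hs)
    rcases (offDegree J.mkQ F a H).eq_empty_or_nonempty with h | h
    · exact Or.inr ⟨_, Step.exit B J H hH h⟩
    · exact Or.inr ⟨_, Step.strip B J H hH h⟩
  | body =>
    obtain ⟨G, hG⟩ := exists_isHomGenerators J.mkQ_surjective _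
      (isMonomial_comap_powerTorsion (isMonomial_facetIdeal (F := F)) hs)
    exact Or.inr ⟨_, Step.torsion B J G hG⟩
  | done => exact Or.inl rfl

theorem le_killIdeal (J : Ideal (Alg k Q)) (G : Set (Alg k Q ⧸ J)) : J ≤ killIdeal J G := by
  intro p hp
  rw [killIdeal, Submodule.mem_comap, Submodule.mkQ_apply, (Submodule.Quotient.mk_eq_zero J).2 hp]
  exact zero_mem _

theorem Step.le {s t : State k Q} (h : Step k Q F a s t) : s.J ≤ t.J := by
  cases h with
  | exit => exact le_rfl
  | strip => exact le_killIdeal _ _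
  | torsion => exact le_killIdeal _ _

theorem lt_killIdeal {J : Ideal (Alg k Q)} {G : Set (Alg k Q ⧸ J)}
    (hG : ∀ g ∈ G, g ≠ 0) (hne : G.Nonempty) : J < killIdeal J G := by
  refine lt_of_le_of_ne (le_killIdeal J G) fun h => ?_
  obtain ⟨g, hg⟩ := hne
  obtain ⟨p, rfl⟩ := J.mkQ_surjective g
  have hp : p ∈ killIdeal J G := Submodule.subset_span hg
  rw [← h] at hp
  exact hG _ hg ((Submodule.Quotient.mk_eq_zero J).2 hp)

/-- The Γ_I step may be trivial, but of two consecutive steps not ending in `done` one is a `strip`,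
which is strict. -/
theorem Step.lt_of_lt {s t u : State k Q} (hst : Step k Q F a s t) (htu : Step k Q F a t u)
    (huv : u.stage ≠ Stage.done) : s.J < u.J := by
  have hne : ∀ {J : Ideal (Alg k Q)} {N : Submodule (Alg k Q) (Alg k Q ⧸ J)} {H},
      IsHomGenerators J.mkQ N H → ∀ g ∈ offDegree J.mkQ F a H, g ≠ 0 := fun hH g hg =>
    (hH.2.1 g hg.1).elim fun _ h => h.1
  cases hst with
  | exit => cases htu
  | strip B J H hH hoff => exact (lt_killIdeal (hne hH) hoff).trans_le htu.le
  | torsion B J G hG =>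
    cases htu with
    | exit => exact absurd rfl huv
    | strip _ _ H hH hoff => exact (le_killIdeal _ _).trans_lt (lt_killIdeal (hne hH) hoff)

theorem not_exists_infinite_run (hfg : Q.FG) :
    ¬ ∃ r : ℕ → State k Q, ∀ n, Step k Q F a (r n) (r (n + 1)) := by
  rintro ⟨r, hr⟩
  have := isNoetherianRing_alg (k := k) hfg
  have hdone : ∀ n, (r n).stage ≠ Stage.done := by
    intro n h
    have := hr n
    generalize r (n + 1) = t at this
    generalize r n = s at this h
    cases this <;> cases h
  -- Pairing the steps works whichever stage the run starts in.
  have hmono : StrictMono fun n => (r (2 * n)).J := strictMono_nat_of_lt_succ fun n =>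
    (hr (2 * n)).lt_of_lt (hr (2 * n + 1)) (hdone _)
  exact not_strictMono_of_wellFoundedGT _ hmono

end Algorithm

end UnsatAlgorithm

theorem propositionp (k : Type*) [Field k] (d : ℕ) (Q : AddSubmonoid (Fin d → ℤ))
    (hfg : Q.FG) (hsharp : ∀ q ∈ Q, -q ∈ Q → q = 0)
    (hgen : AddSubgroup.closure (Q : Set (Fin d → ℤ)) = ⊤)
    (F : Set (Fin d → ℤ)) (hF : UnsatAlgorithm.IsFace Q F)
    (a : Fin d → ℤ) (ha : a ∈ Q) :
    -- the algorithm can be started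
    (∃ s, UnsatAlgorithm.Initial k Q F a s) ∧
    -- it never gets stuck, whatever generators have been chosen
    (∀ s, UnsatAlgorithm.Reachable k Q F a s →
      s.stage = UnsatAlgorithm.Stage.done ∨ ∃ t, UnsatAlgorithm.Step k Q F a s t) ∧
    -- it terminates, whatever generators are chosen
    (¬ ∃ r : ℕ → UnsatAlgorithm.State k Q, UnsatAlgorithm.Initial k Q F a (r 0) ∧
      ∀ n, UnsatAlgorithm.Step k Q F a (r n) (r (n + 1))) ∧
    -- its output is a finite set of generating degrees of the irreducible ideal `k{Q ∖ (a + F - Q)}`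
    (∀ s, UnsatAlgorithm.Reachable k Q F a s → s.stage = UnsatAlgorithm.Stage.done →
      s.B.Finite ∧
      (UnsatAlgorithm.monoIdeal k s.B).restrictScalars k =
        UnsatAlgorithm.kspan k (UnsatAlgorithm.cut Q F a) ∧
      InfIrred (UnsatAlgorithm.monoIdeal k s.B)) := by
  have hinv : ∀ s : UnsatAlgorithm.State k Q, UnsatAlgorithm.Reachable k Q F a s →
      UnsatAlgorithm.Invariant F a s := fun s => UnsatAlgorithm.Reachable.invariant hfg hF
  refine ⟨UnsatAlgorithm.exists_initial hfg,
    fun s hs => UnsatAlgorithm.exists_step hfg (hinv s hs).isMonomial, ?_, ?_⟩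
  · rintro ⟨r, -, hr⟩
    exact UnsatAlgorithm.not_exists_infinite_run hfg ⟨r, hr⟩
  · intro s hs hdone
    have h := hinv s hs
    have heq : UnsatAlgorithm.monoIdeal k s.B =
        UnsatAlgorithm.monoIdeal k (UnsatAlgorithm.cut Q F a) :=
      h.eq_monoIdeal ▸ le_antisymm h.le_cut (h.cut_le hdone)
    rw [heq]
    refine ⟨h.finite, UnsatAlgorithm.monoIdeal_eq_kspan k _ fun b hb s => ?_,
      UnsatAlgorithm.infIrred_monoIdeal_cut hfg hF ha⟩
    rw [add_comm]
    exact UnsatAlgorithm.add_mem_cut hb s
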